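/- Let $\mathbb{T}=[0,\infty)$ in continuous time (CT) and $\mathbb{T}=\mathbb{N}$ in discrete time (DT). Let $\mathbb{P}\subseteq\mathbb{R}^{n_{\mathrm p}}$ and let $$\Sigma:\qquad \xi x(t)=A(p(t))x(t)+B(p(t))u(t),\qquad y(t)=C(p(t))x(t)+D(p(t))u(t),$$ where $\xi x=\frac{d}{dt}x$ in CT and $(\xi x)(t)=x(t+1)$ in DT, and where $A(\mathbf p)=A_0+\sum_{i=1}^{n_{\mathrm p}}A_i\mathbf p_i$ for $\mathbf p\in\mathbb{P}$, and $B,C,D$ are affine in the same way, with real matrices $A_i\in\mathbb{R}^{n_{\mathrm x}\times n_{\mathrm x}}$, $B_i\in\mathbb{R}^{n_{\mathrm x}\times n_{\mathrm u}}$, $C_i\in\mathbb{R}^{n_{\mathrm y}\times n_{\mathrm x}}$, $D_i\in\mathbb{R}^{n_{\mathrm y}\times n_{\mathrm u}}$ (an LPV-SSA). In DT all sequences are admitted as states $x$, outputs $y\in\mathcal{Y}$, inputs $u\in\mathcal{U}$ and $\mathbb{P}$-valued scheduling signals $p\in\mathcal{P}$. In CT, $x$ is locally absolutely continuous, $u\in\mathcal{U}$,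 $y\in\mathcal{Y}$ and $p\in\mathcal{P}$ are piecewise continuous (finitely many discontinuities on each bounded interval, finite one-sided limits everywhere), and $p$ is $\mathbb{P}$-valued. A solution is a tuple $(x,y,u,p)$ of such signals that satisfies the two equations for all $t$ in DT and for almost all $t$ in CT. For $x_{\mathrm o}\in\mathbb{R}^{n_{\mathrm x}}$, the i/o function $\mathfrak{Y}_{\Sigma,x_{\mathrm o}}:\mathcal{U}\times\mathcal{P}\to\mathcal{Y}$ assigns to $(u,p)$ the output $y$ of the solution with $x(0)=x_{\mathrm o}$; in CT this output is determined up to null sets, and i/o functions are compared accordingly. $\Sigma$ is observable if $x_1\neq x_2$ implies $\mathfrak{Y}_{\Sigma,x_1}\neq\mathfrak{Y}_{\Sigma,x_2}$. $\Sigma$ satisfies the regularity certificate (RC) if $\mathbb{P}$ is convex with non-empty interior and, in DT, moreover $A(\mathbf p)$ is invertible for all $\mathbf p\in\mathbb{P}$. Theorem. Let $\Sigma$ be an observable LPV-SSA which satisfies RC. Then there exist a scheduling signal $p_{\mathrm o}\in\mathcal{P}$ and $t_{\mathrm o}\in\mathbb{T}$ such that for any two initial states $x_1,x_2\in\mathbb{R}^{n_{\mathrm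 x}}$ $$\mathfrak{Y}_{\Sigma,x_1}(0,p_{\mathrm o})|_{[0,t_{\mathrm o}]}=\mathfrak{Y}_{\Sigma,x_2}(0,p_{\mathrm o})|_{[0,t_{\mathrm o}]}\ \Longrightarrow\ \mathfrak{Y}_{\Sigma,x_1}=\mathfrak{Y}_{\Sigma,x_2},$$ where in CT equality on the left means that some outputs $y_1,y_2$ representing the two sides agree at every point of $[0,t_{\mathrm o}]$. In CT, $p_{\mathrm o}$ can moreover be chosen real analytic on $[0,\infty)$. -/

import Mathlib

open MeasureTheory Filter Topology Set
open scoped NNReal Matrix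

/-- An LPV state-space representation with affine dependence on the scheduling variable:
a scheduling set `P ⊆ ℝ^np` and matrices `A i`, `B i`, `C i`, `D i` for `i = 0, …, np`. -/
structure LPVSSA (nx nu ny np : ℕ) where
  P : Set (Fin np → ℝ)
  A : Fin (np + 1) → Matrix (Fin nx) (Fin nx) ℝ
  B : Fin (np + 1) → Matrix (Fin nx) (Fin nu) ℝ
  C : Fin (np + 1) → Matrix (Fin ny) (Fin nx) ℝ
  D : Fin (np + 1) → Matrix (Fin ny) (Fin nu) ℝ

/-- The affine matrix function `M 0 + ∑ i, q i • M (i + 1)`. -/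
def affineEval {m n np : ℕ} (M : Fin (np + 1) → Matrix (Fin m) (Fin n) ℝ)
    (q : Fin np → ℝ) : Matrix (Fin m) (Fin n) ℝ :=
  M 0 + ∑ i : Fin np, q i • M i.succ

namespace LPVSSA

variable {nx nu ny np : ℕ}

/-- Regularity certificate in continuous time. -/
def RegularCT (S : LPVSSA nx nu ny np) : Prop :=
  Convex ℝ S.P ∧ (interior S.P).Nonempty

/-- Regularity certificate in discrete time. -/
def RegularDT (S : LPVSSA nx nu ny np) : Prop :=
  (Convex ℝ S.P ∧ (interior S.P).Nonempty) ∧ ∀ q ∈ S.P, IsUnit (affineEval S.A q)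

end LPVSSA

/-! Discrete time: the time axis is `ℕ`. -/

/-- Discrete-time scheduling signals: all sequences in `P`. -/
abbrev SchedDT {np : ℕ} (P : Set (Fin np → ℝ)) : Type :=
  {p : ℕ → Fin np → ℝ // ∀ t, p t ∈ P}

namespace LPVSSA

variable {nx nu ny np : ℕ}

/-- `(x, y, u, p)` is a solution of the discrete-time system. -/
def IsSolutionDT (S : LPVSSA nx nu ny np) (x : ℕ → Fin nx → ℝ) (y : ℕ → Fin ny → ℝ)
    (u : ℕ → Fin nu → ℝ) (p : SchedDT S.P) : Prop :=
  ∀ t, x (t + 1) = affineEval S.A (p.1 t) *ᵥ x t + affineEval S.B (p.1 t) *ᵥ u t ∧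
    y t = affineEval S.C (p.1 t) *ᵥ x t + affineEval S.D (p.1 t) *ᵥ u t

/-- The i/o function induced by the initial state `x₀`, given by the outputs `y` that belong to
`(u, p)`, i.e. `y ∈ S.ioDT x₀ u p` says that `y` is the value of the i/o function at `(u, p)`. -/
def ioDT (S : LPVSSA nx nu ny np) (x₀ : Fin nx → ℝ) (u : ℕ → Fin nu → ℝ) (p : SchedDT S.P) :
    Set (ℕ → Fin ny → ℝ) :=
  {y | ∃ x, S.IsSolutionDT x y u p ∧ x 0 = x₀}

/-- Observability: distinct initial states induce distinct i/o functions. -/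
def ObservableDT (S : LPVSSA nx nu ny np) : Prop :=
  ∀ x₁ x₂ : Fin nx → ℝ, x₁ ≠ x₂ → S.ioDT x₁ ≠ S.ioDT x₂

end LPVSSA

/-! Continuous time: the time axis is `ℝ≥0 = [0, ∞)`. -/

/-- Piecewise continuity on `[0, ∞)`: finitely many discontinuities in every bounded interval,
and finite one-sided limits everywhere (at `0` the limit from the left is void). -/
def PiecewiseCont {n : ℕ} (f : ℝ≥0 → Fin n → ℝ) : Prop :=
  (∀ T : ℝ≥0, {t | t ≤ T ∧ ¬ ContinuousAt f t}.Finite) ∧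
    ∀ t : ℝ≥0, (∃ l, Tendsto f (𝓝[>] t) (𝓝 l)) ∧ (∃ l, Tendsto f (𝓝[<] t) (𝓝 l))

theorem PiecewiseCont.of_continuous {n : ℕ} {f : ℝ≥0 → Fin n → ℝ} (hf : Continuous f) :
    PiecewiseCont f :=
  ⟨fun T => by simp [hf.continuousAt],
    fun t => ⟨⟨f t, hf.continuousAt.mono_left nhdsWithin_le_nhds⟩,
      ⟨f t, hf.continuousAt.mono_left nhdsWithin_le_nhds⟩⟩⟩

/-- Extension of a function on `[0, ∞)` to `ℝ`, constant on `(-∞, 0]`. -/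
def extendReal {n : ℕ} (f : ℝ≥0 → Fin n → ℝ) : ℝ → Fin n → ℝ := fun t => f t.toNNReal

/-- (Local) absolute continuity on `[0, ∞)`: absolute continuity on every `[0, T]`. -/
def LocallyAbsCont {n : ℕ} (f : ℝ≥0 → Fin n → ℝ) : Prop :=
  ∀ T : ℝ≥0, AbsolutelyContinuousOnInterval (extendReal f) 0 T

/-- Real analyticity on `[0, ∞)`: a convergent power series at every `t ≥ 0`
(one-sided at `t = 0`). -/
def AnalyticSignal {n : ℕ} (f : ℝ≥0 → Fin n → ℝ) : Prop :=
  AnalyticOn ℝ (extendReal f) (Ici 0)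

/-- Piecewise continuous signals `[0, ∞) → ℝ^n`. -/
abbrev SignalCT (n : ℕ) : Type := {f : ℝ≥0 → Fin n → ℝ // PiecewiseCont f}

instance (n : ℕ) : Zero (SignalCT n) :=
  ⟨⟨fun _ => 0, PiecewiseCont.of_continuous continuous_const⟩⟩

/-- Continuous-time scheduling signals: piecewise continuous with values in `P`. -/
abbrev SchedCT {np : ℕ} (P : Set (Fin np → ℝ)) : Type :=
  {p : ℝ≥0 → Fin np → ℝ // PiecewiseCont p ∧ ∀ t, p t ∈ P}

namespace LPVSSA

variable {nx nu ny np : ℕ}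

/-- `(x, y, u, p)` is a solution of the continuous-time system: `x` is (locally) absolutely
continuous and both equations hold for almost every `t ≥ 0`. -/
def IsSolutionCT (S : LPVSSA nx nu ny np) (x : ℝ≥0 → Fin nx → ℝ) (y : SignalCT ny)
    (u : SignalCT nu) (p : SchedCT S.P) : Prop :=
  LocallyAbsCont x ∧
    ∀ᵐ s : ℝ, ∀ t : ℝ≥0, (t : ℝ) = s →
      HasDerivAt (extendReal x)
        (affineEval S.A (p.1 t) *ᵥ x t + affineEval S.B (p.1 t) *ᵥ u.1 t) s ∧
      y.1 t = affineEval S.C (p.1 t) *ᵥ x t + affineEval S.D (p.1 t) *ᵥ u.1 t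

/-- The i/o function induced by the initial state `x₀`, given by the outputs `y` that belong to
`(u, p)`. As the equations hold almost everywhere, these are the piecewise continuous
representatives of one output up to null sets, so that equality of `S.ioCT x₁` and `S.ioCT x₂`
is equality of the i/o functions with outputs taken up to null sets. -/
def ioCT (S : LPVSSA nx nu ny np) (x₀ : Fin nx → ℝ) (u : SignalCT nu) (p : SchedCT S.P) :
    Set (SignalCT ny) :=
  {y | ∃ x, S.IsSolutionCT x y u p ∧ x 0 = x₀}

/-- Observability: distinct initial states induce distinct i/o functions. -/
def ObservableCT (S : LPVSSA nx nu ny np) : Prop :=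
  ∀ x₁ x₂ : Fin nx → ℝ, x₁ ≠ x₂ → S.ioCT x₁ ≠ S.ioCT x₂

end LPVSSA

/-! Encode a piecewise constant experiment as a word, and let `unobs` be the subspace of states it
cannot tell from zero. Appending letters only shrinks this subspace, so in finite dimension some
word `w` attains a minimal one. A state in it stays undetected however `w` is continued, so the flow
along `w` carries it into the intersection Z over all words. Z is invariant under every A(v) and
killed by every C(v); states differing by an element of Z thus have the same i/o function, and
observability forces Z = 0. The flow is injective (A(v) is invertible in discrete time, exponentials
always are), so already `w` detects every nonzero state (`exists_unobs_eq_bot`). In discrete time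
`w`, padded by a constant, is the schedule.

In continuous time the signal of `w` jumps. Replacing the jumps by sigmoids of slope n gives
analytic signals, with values in P by convexity. Some n works: otherwise each n has a nonzero
undetected initial state, and after normalisation a subsequence converges to a unit vector. The
trajectories converge to the piecewise constant flow (`tendsto_flow_of_tendsto`), so `w` fails to
detect this vector (`mem_unobs_of_follows`), a contradiction. -/

/-! ### Unobservable subspaces along words -/

section Words

variable {L E Y : Type*} [AddCommGroup E] [Module ℝ E] [AddCommGroup Y] [Module ℝ Y]

/-- The states from which all outputs along a word vanish, where a letter `l` acts on states by
`F l` and is observed through `H l`. -/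
def unobs (F : L → E →ₗ[ℝ] E) (H : L → E →ₗ[ℝ] Y) : List L → Submodule ℝ E
  | [] => ⊤
  | l :: w => LinearMap.ker (H l) ⊓ (unobs F H w).comap (F l)

/-- The action of a word on states. -/
def wordFlow (F : L → E →ₗ[ℝ] E) : List L → E →ₗ[ℝ] E
  | [] => LinearMap.id
  | l :: w => wordFlow F w ∘ₗ F l

theorem mem_unobs_cons {F : L → E →ₗ[ℝ] E} {H : L → E →ₗ[ℝ] Y} {l : L} {w : List L} {x : E} :
    x ∈ unobs F H (l :: w) ↔ H l x = 0 ∧ F l x ∈ unobs F H w := by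
  simp [unobs]

theorem mem_unobs_append {F : L → E →ₗ[ℝ] E} {H : L → E →ₗ[ℝ] Y} (w₁ w₂ : List L) (x : E) :
    x ∈ unobs F H (w₁ ++ w₂) ↔ x ∈ unobs F H w₁ ∧ wordFlow F w₁ x ∈ unobs F H w₂ := by
  induction w₁ generalizing x with
  | nil => simp [unobs, wordFlow]
  | cons l w ih => simp [mem_unobs_cons, ih, wordFlow, and_assoc]

theorem wordFlow_injective {F : L → E →ₗ[ℝ] E} (hF : ∀ l, Function.Injective (F l))
    (w : List L) : Function.Injective (wordFlow F w) := by
  induction w with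
  | nil => exact Function.injective_id
  | cons l w ih => exact ih.comp (hF l)

/-- Take a word with minimal unobservable subspace. By minimality no continuation shrinks it, so its
flow maps that subspace into the intersection over all words, which is zero; injectivity of the flow
concludes. -/
theorem exists_unobs_eq_bot [FiniteDimensional ℝ E] {F : L → E →ₗ[ℝ] E} {H : L → E →ₗ[ℝ] Y}
    (hF : ∀ l, Function.Injective (F l)) (hZ : ⨅ w, unobs F H w = ⊥) :
    ∃ w, unobs F H w = ⊥ := by
  obtain ⟨w, hw⟩ := exists_minimal_of_wellFoundedLT (fun U => U ∈ range (unobs F H))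
    ⟨_, mem_range_self []⟩
  obtain ⟨⟨w, rfl⟩, hmin⟩ := hw
  refine ⟨w, (Submodule.eq_bot_iff _).2 fun x hx => ?_⟩
  have hflow : wordFlow F w x ∈ ⨅ w', unobs F H w' := by
    refine Submodule.mem_iInf _ |>.2 fun w' => ?_
    have hle : unobs F H (w ++ w') ≤ unobs F H w := fun z hz => ((mem_unobs_append _ _ _).1 hz).1
    exact ((mem_unobs_append _ _ _).1 (hmin (mem_range_self (w ++ w')) hle hx)).2
  rw [hZ, Submodule.mem_bot] at hflow
  exact wordFlow_injective hF w (by simpa using hflow)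

theorem apply_eq_zero_of_mem_iInf_unobs {F : L → E →ₗ[ℝ] E} {H : L → E →ₗ[ℝ] Y} {x : E}
    (hx : x ∈ ⨅ w, unobs F H w) (l : L) : H l x = 0 :=
  (mem_unobs_cons.1 ((Submodule.mem_iInf _).1 hx [l])).1

theorem apply_mem_iInf_unobs {F : L → E →ₗ[ℝ] E} {H : L → E →ₗ[ℝ] Y} {x : E}
    (hx : x ∈ ⨅ w, unobs F H w) (l : L) : F l x ∈ ⨅ w, unobs F H w :=
  (Submodule.mem_iInf _).2 fun w => (mem_unobs_cons.1 ((Submodule.mem_iInf _).1 hx (l :: w))).2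

end Words

/-! ### Discrete time -/

section DiscreteTime

namespace LPVSSA

variable {nx nu ny np : ℕ}

/-- The one-step state map for a constant scheduling value. -/
def stepDT (S : LPVSSA nx nu ny np) (v : S.P) : (Fin nx → ℝ) →ₗ[ℝ] (Fin nx → ℝ) :=
  (affineEval S.A v).mulVecLin

/-- The output map for a constant scheduling value. -/
def outDT (S : LPVSSA nx nu ny np) (v : S.P) : (Fin nx → ℝ) →ₗ[ℝ] (Fin ny → ℝ) :=
  (affineEval S.C v).mulVecLin

/-- The zero-input trajectory from `ξ` stays in `Z`, so superposing it on a solution leaves the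
output unchanged. -/
theorem ioDT_subset_add (S : LPVSSA nx nu ny np) {Z : Submodule ℝ (Fin nx → ℝ)}
    (hA : ∀ v ∈ S.P, ∀ z ∈ Z, affineEval S.A v *ᵥ z ∈ Z)
    (hC : ∀ v ∈ S.P, ∀ z ∈ Z, affineEval S.C v *ᵥ z = 0) (x : Fin nx → ℝ) {ξ : Fin nx → ℝ}
    (hξ : ξ ∈ Z) (u : ℕ → Fin nu → ℝ) (p : SchedDT S.P) : S.ioDT x u p ⊆ S.ioDT (x + ξ) u p := by
  rintro y ⟨X, hX, rfl⟩
  let W : ℕ → Fin nx → ℝ := fun t => Nat.rec ξ (fun k z => affineEval S.A (p.1 k) *ᵥ z) t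
  have hW : ∀ t, W t ∈ Z := fun t => by
    induction t with
    | zero => exact hξ
    | succ t ih => exact hA _ (p.2 t) _ ih
  refine ⟨fun t => X t + W t, fun t => ⟨?_, ?_⟩, rfl⟩
  · change X (t + 1) + affineEval S.A (p.1 t) *ᵥ W t = affineEval S.A (p.1 t) *ᵥ (X t + W t) + _
    rw [(hX t).1, Matrix.mulVec_add, add_right_comm]
  · rw [(hX t).2, Matrix.mulVec_add, hC _ (p.2 t) _ (hW t), add_zero]

theorem ioDT_add_eq (S : LPVSSA nx nu ny np) {Z : Submodule ℝ (Fin nx → ℝ)}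
    (hA : ∀ v ∈ S.P, ∀ z ∈ Z, affineEval S.A v *ᵥ z ∈ Z)
    (hC : ∀ v ∈ S.P, ∀ z ∈ Z, affineEval S.C v *ᵥ z = 0) (x : Fin nx → ℝ) {ξ : Fin nx → ℝ}
    (hξ : ξ ∈ Z) : S.ioDT (x + ξ) = S.ioDT x := by
  funext u p
  refine Subset.antisymm ?_ (S.ioDT_subset_add hA hC x hξ u p)
  simpa using S.ioDT_subset_add hA hC (x + ξ) (Z.neg_mem hξ) u p

theorem mem_unobs_of_output_zero (S : LPVSSA nx nu ny np) (w : List S.P) (p : ℕ → S.P)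
    (hp : ∀ t (h : t < w.length), p t = w[t]) (X : ℕ → Fin nx → ℝ)
    (hX : ∀ t, X (t + 1) = S.stepDT (p t) (X t))
    (h0 : ∀ t < w.length, S.outDT (p t) (X t) = 0) : X 0 ∈ unobs S.stepDT S.outDT w := by
  induction w generalizing p X with
  | nil => trivial
  | cons l w ih =>
    have hl : p 0 = l := hp 0 (by simp)
    refine mem_unobs_cons.2 ⟨hl ▸ h0 0 (by simp), ?_⟩
    have := ih (fun t => p (t + 1)) (fun t h => hp (t + 1) (by simpa using h))
      (fun t => X (t + 1)) (fun t => hX (t + 1)) fun t h => h0 (t + 1) (by simpa using h)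
    rwa [hX, hl] at this

theorem exists_universal_schedule_DT (S : LPVSSA nx nu ny np) (hS : S.RegularDT)
    (hobs : S.ObservableDT) :
    ∃ (p : SchedDT S.P) (T : ℕ),
      ∀ (x₁ x₂ : Fin nx → ℝ), ∀ y₁ ∈ S.ioDT x₁ 0 p, ∀ y₂ ∈ S.ioDT x₂ 0 p,
        (∀ t ≤ T, y₁ t = y₂ t) → S.ioDT x₁ = S.ioDT x₂ := by
  obtain ⟨⟨-, c, hc⟩, hinv⟩ := hS
  have hZ : ⨅ w, unobs S.stepDT S.outDT w = ⊥ := by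
    refine (Submodule.eq_bot_iff _).2 fun ξ hξ => ?_
    by_contra hne
    refine hobs (0 + ξ) 0 (by simpa using hne) (S.ioDT_add_eq
      (fun v hv z hz => apply_mem_iInf_unobs hz ⟨v, hv⟩)
      (fun v hv z hz => apply_eq_zero_of_mem_iInf_unobs hz ⟨v, hv⟩) 0 hξ)
  obtain ⟨w, hw⟩ := exists_unobs_eq_bot
    (fun l : S.P => Matrix.mulVec_injective_of_isUnit (hinv l l.2)) hZ
  -- The default `c` only pads the signal after the word; the outputs at times below `w.length`
  -- suffice.
  let p : ℕ → S.P := fun t => w.getD t ⟨c, interior_subset hc⟩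
  refine ⟨⟨fun t => p t, fun t => (p t).2⟩, w.length, ?_⟩
  rintro x₁ x₂ y₁ ⟨X₁, h₁, rfl⟩ y₂ ⟨X₂, h₂, rfl⟩ hy
  have : X₁ 0 - X₂ 0 ∈ unobs S.stepDT S.outDT w := by
    refine S.mem_unobs_of_output_zero w p (fun t h => by simp [p, h]) (fun t => X₁ t - X₂ t)
      (fun t => ?_) fun t ht => ?_
    · simp only [(h₁ t).1, (h₂ t).1, stepDT, Matrix.mulVecLin_apply, Matrix.mulVec_sub]
      abel
    · have := hy t ht.le
      rw [(h₁ t).2, (h₂ t).2] at this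
      simpa [outDT, Matrix.mulVec_sub, sub_eq_zero] using this
  rw [hw, Submodule.mem_bot, sub_eq_zero] at this
  rw [this]

end LPVSSA

end DiscreteTime

/-! ### Linear Volterra equations with measurable, locally bounded coefficients -/

section Volterra

variable {E : Type*} [NormedAddCommGroup E] [NormedSpace ℝ E]

theorem intervalIntegrable_clm_apply {M : ℝ → E →L[ℝ] E} (hM : AEStronglyMeasurable M volume)
    (hb : ∀ T, ∃ K, ∀ t ≤ T, ‖M t‖ ≤ K) {f : ℝ → E} (hf : Continuous f) (a b : ℝ) :
    IntervalIntegrable (fun s => M s (f s)) volume a b := by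
  obtain ⟨K, hK⟩ := hb (max a b)
  obtain ⟨R, hR⟩ := (isCompact_uIcc (a := a) (b := b)).exists_bound_of_continuousOn hf.continuousOn
  have hmeas : AEStronglyMeasurable (fun s => M s (f s)) volume :=
    (ContinuousLinearMap.id ℝ (E →L[ℝ] E)).aestronglyMeasurable_comp₂ hM
      hf.aestronglyMeasurable
  refine (intervalIntegrable_const (c := K * R)).mono_fun' hmeas.restrict ?_
  filter_upwards [ae_restrict_mem measurableSet_uIoc] with s hs
  exact (M s).le_of_opNorm_le_of_le (hK s hs.2) (hR s (uIoc_subset_uIcc hs))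

/-- The iterated integrals whose sum solves a linear Volterra equation. -/
noncomputable def volterraIter (M : ℝ → E →L[ℝ] E) (x₀ : E) : ℕ → ℝ → E
  | 0 => fun _ => x₀
  | k + 1 => fun t => ∫ s in (0 : ℝ)..t, M s (volterraIter M x₀ k s)

theorem continuous_volterraIter {M : ℝ → E →L[ℝ] E} (hM : AEStronglyMeasurable M volume)
    (hb : ∀ T, ∃ K, ∀ t ≤ T, ‖M t‖ ≤ K) (x₀ : E) (k : ℕ) :
    Continuous (volterraIter M x₀ k) := by
  induction k with
  | zero => exact continuous_const
  | succ k ih =>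
    exact intervalIntegral.continuous_primitive (intervalIntegrable_clm_apply hM hb ih) 0

theorem norm_volterraIter_le {M : ℝ → E →L[ℝ] E} {T K : ℝ} (hK : ∀ t ≤ T, ‖M t‖ ≤ K) (x₀ : E)
    (k : ℕ) {t : ℝ} (h0 : 0 ≤ t) (ht : t ≤ T) :
    ‖volterraIter M x₀ k t‖ ≤ ‖x₀‖ * ((K * t) ^ k / k.factorial) := by
  have hK0 : 0 ≤ K := (norm_nonneg _).trans (hK t ht)
  induction k generalizing t with
  | zero => simp [volterraIter]
  | succ k ih =>
    calc ‖volterraIter M x₀ (k + 1) t‖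
        ≤ ∫ s in (0 : ℝ)..t, K * (‖x₀‖ * ((K * s) ^ k / k.factorial)) := by
          refine intervalIntegral.norm_integral_le_of_norm_le h0 (ae_of_all _ fun s hs => ?_)
            (Continuous.intervalIntegrable (by fun_prop) _ _)
          exact (M s).le_of_opNorm_le_of_le (hK s (hs.2.trans ht))
            (ih hs.1.le (hs.2.trans ht))
      _ = ∫ s in (0 : ℝ)..t, K ^ (k + 1) * ‖x₀‖ / k.factorial * s ^ k := by
          congr 1; ext s; ring
      _ = ‖x₀‖ * ((K * t) ^ (k + 1) / (k + 1).factorial) := by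
          rw [intervalIntegral.integral_const_mul, integral_pow, Nat.factorial_succ]
          push_cast
          field_simp
          simp only [ne_eq, Nat.add_eq_zero_iff, one_ne_zero, and_false, not_false_eq_true,
            zero_pow, sub_zero]
          ring

/-- The Picard series is dominated on [0, T] by an exponential series, so it can be integrated
termwise; integration shifts the index by one. -/
theorem exists_volterra_solution [CompleteSpace E] {M : ℝ → E →L[ℝ] E}
    (hM : AEStronglyMeasurable M volume) (hb : ∀ T, ∃ K, ∀ t ≤ T, ‖M t‖ ≤ K) (x₀ : E) :
    ∃ w : ℝ → E, Continuous w ∧ ∀ t ≥ 0, w t = x₀ + ∫ s in (0 : ℝ)..t, M s (w s) := by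
  have hsum : ∀ c : ℝ, Summable fun k : ℕ => ‖x₀‖ * (c ^ k / k.factorial) := fun c =>
    (Real.summable_pow_div_factorial c).mul_left _
  have hbound : ∀ T ≥ 0, ∀ K, (∀ t ≤ T, ‖M t‖ ≤ K) → ∀ k, ∀ t ≤ T, 0 ≤ t →
      ‖volterraIter M x₀ k t‖ ≤ ‖x₀‖ * ((K * T) ^ k / k.factorial) := by
    intro T hT K hK k t ht h0
    have hK0 : 0 ≤ K := (norm_nonneg _).trans (hK t ht)
    refine (norm_volterraIter_le hK x₀ k h0 ht).trans ?_
    gcongr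
  -- The factorial bound holds for nonnegative times only; truncating at 0 gives continuity on the
  -- whole line.
  let w : ℝ → E := fun t => ∑' k, volterraIter M x₀ k (max t 0)
  have hw : Continuous w := by
    refine continuous_iff_continuousAt.2 fun t₀ => ?_
    obtain ⟨K, hK⟩ := hb (max (t₀ + 1) 0)
    refine (continuousOn_tsum (s := Iic (t₀ + 1))
      (fun k => ((continuous_volterraIter hM hb x₀ k).comp (by fun_prop)).continuousOn)
      (hsum (K * max (t₀ + 1) 0)) fun k t ht => ?_).continuousAt (Iic_mem_nhds (by linarith))
    exact hbound _ (le_max_right _ _) K hK k _ (max_le_max_right 0 ht) (le_max_right _ _)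
  refine ⟨w, hw, fun t ht => ?_⟩
  obtain ⟨K, hK⟩ := hb t
  have hS : ∀ s ∈ Icc 0 t, HasSum (fun k => volterraIter M x₀ k s) (w s) := fun s hs => by
    have : w s = ∑' k, volterraIter M x₀ k s := by simp [w, hs.1]
    rw [this]
    exact (Summable.of_norm_bounded (hsum (K * t))
      fun k => hbound t ht K hK k s hs.2 hs.1).hasSum
  have hI : HasSum (fun k => volterraIter M x₀ (k + 1) t) (∫ s in (0 : ℝ)..t, M s (w s)) := by
    refine intervalIntegral.hasSum_integral_of_dominated_convergence
      (fun k _ => K * (‖x₀‖ * ((K * t) ^ k / k.factorial)))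
      (fun k => ((intervalIntegrable_clm_apply hM hb
        (continuous_volterraIter hM hb x₀ k) 0 t).def').aestronglyMeasurable)
      (fun k => ae_of_all _ fun s hs => ?_) (ae_of_all _ fun s hs => (hsum _).mul_left _)
      intervalIntegrable_const (ae_of_all _ fun s hs => ?_)
    · rw [uIoc_of_le ht] at hs
      exact (M s).le_of_opNorm_le_of_le (hK s hs.2) (hbound t ht K hK k s hs.2 hs.1.le)
    · rw [uIoc_of_le ht] at hs
      exact (hS s ⟨hs.1.le, hs.2⟩).mapL (M s)
  have h1 := hS t ⟨ht, le_rfl⟩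
  rw [← h1.tsum_eq, h1.summable.tsum_eq_zero_add, hI.tsum_eq]
  rfl

end Volterra

/-! ### From flows and sampled outputs back to A(v) and C(v) -/

section Generators

variable {V E Y : Type*} [NormedAddCommGroup E] [NormedSpace ℝ E] [NormedAddCommGroup Y]
  [NormedSpace ℝ Y] {P : Set V}

/-- The total duration of a word. -/
def duration (w : List (P × Ioi (0 : ℝ))) : ℝ := (w.map fun l => l.2.1).sum

theorem duration_nonneg (w : List (P × Ioi (0 : ℝ))) : 0 ≤ duration w :=
  List.sum_nonneg fun x hx => by
    obtain ⟨l, -, rfl⟩ := List.mem_map.1 hx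
    exact (mem_Ioi.1 l.2.2).le

/-- The flow of `x' = A v x` over the duration of a letter. -/
noncomputable def stepCT (A : V → E →L[ℝ] E) (l : P × Ioi (0 : ℝ)) : E →ₗ[ℝ] E :=
  (NormedSpace.exp (l.2.1 • A l.1) : E →L[ℝ] E)

/-- The output at half of the duration of a letter. -/
noncomputable def outCT (A : V → E →L[ℝ] E) (C : V → E →L[ℝ] Y) (l : P × Ioi (0 : ℝ)) :
    E →ₗ[ℝ] Y :=
  (C l.1 ∘L (NormedSpace.exp ((l.2.1 / 2) • A l.1) : E →L[ℝ] E) : E →L[ℝ] Y)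

variable [CompleteSpace E]

theorem exp_smul_apply_exp_neg_smul (A : E →L[ℝ] E) (t : ℝ) (x : E) :
    (NormedSpace.exp (t • A) : E →L[ℝ] E) ((NormedSpace.exp (-(t • A)) : E →L[ℝ] E) x) = x := by
  let _ : NormedAlgebra ℚ (E →L[ℝ] E) := .restrictScalars ℚ ℝ _
  rw [← mul_apply_eq_comp, ← NormedSpace.exp_add_of_commute]
  · simp
  · exact (Commute.refl _).neg_right

theorem exp_neg_smul_apply_exp_smul (A : E →L[ℝ] E) (t : ℝ) (x : E) :
    (NormedSpace.exp (-(t • A)) : E →L[ℝ] E) ((NormedSpace.exp (t • A) : E →L[ℝ] E) x) = x := by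
  simpa using exp_smul_apply_exp_neg_smul A (-t) x

theorem stepCT_injective (A : V → E →L[ℝ] E) (l : P × Ioi (0 : ℝ)) :
    Function.Injective (stepCT A l) :=
  Function.LeftInverse.injective (g := (NormedSpace.exp (-(l.2.1 • A l.1)) : E →L[ℝ] E))
    fun x => exp_neg_smul_apply_exp_smul _ _ x

/-- Test with one-letter words and let the duration tend to 0. -/
theorem output_eq_zero_of_mem_iInf_unobs {A : V → E →L[ℝ] E} {C : V → E →L[ℝ] Y} {x : E}
    (hx : x ∈ ⨅ w : List (P × Ioi (0 : ℝ)), unobs (stepCT A) (outCT A C) w) {v : V}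
    (hv : v ∈ P) : C v x = 0 := by
  have hc : Continuous fun s : ℝ =>
      C v ((NormedSpace.exp ((s / 2) • A v) : E →L[ℝ] E) x) := by
    have : Continuous fun s : ℝ => NormedSpace.exp (s • A v) :=
      continuous_iff_continuousAt.2 fun r => 
      (hasDerivAt_exp_smul_const (𝕂 := ℝ) (A v) r).continuousAt
    exact (C v).continuous.comp
      ((this.comp (continuous_id.div_const 2)).clm_apply continuous_const)
  have h1 : Tendsto (fun s : ℝ => C v ((NormedSpace.exp ((s / 2) • A v) : E →L[ℝ] E) x))
      (𝓝[>] 0) (𝓝 (C v x)) := by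
    simpa using (hc.tendsto 0).mono_left nhdsWithin_le_nhds
  refine tendsto_nhds_unique h1 (tendsto_const_nhds.congr' ?_)
  filter_upwards [self_mem_nhdsWithin] with s hs
  exact (apply_eq_zero_of_mem_iInf_unobs hx (⟨v, hv⟩, ⟨s, hs⟩)).symm

/-- A(v)x is the right derivative at 0 of the flow, which stays in a closed subspace. -/
theorem generator_mem_iInf_unobs [FiniteDimensional ℝ E] {A : V → E →L[ℝ] E}
    {C : V → E →L[ℝ] Y} {x : E}
    (hx : x ∈ ⨅ w : List (P × Ioi (0 : ℝ)), unobs (stepCT A) (outCT A C) w) {v : V}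
    (hv : v ∈ P) : A v x ∈ ⨅ w : List (P × Ioi (0 : ℝ)), unobs (stepCT A) (outCT A C) w := by
  set Z := ⨅ w : List (P × Ioi (0 : ℝ)), unobs (stepCT A) (outCT A C) w with hZ
  have hd : HasDerivAt (fun s : ℝ => (NormedSpace.exp (s • A v) : E →L[ℝ] E) x) (A v x) 0 := by
    have := (hasDerivAt_exp_smul_const (𝕂 := ℝ) (A v) 0).clm_apply (hasDerivAt_const 0 x)
    simpa using this
  refine Z.closed_of_finiteDimensional.mem_of_tendsto
    (hd.tendsto_slope_zero_right) ?_
  filter_upwards [self_mem_nhdsWithin] with s hs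
  refine Z.smul_mem _ (Z.sub_mem ?_ ?_)
  · rw [zero_add]
    exact apply_mem_iInf_unobs hx (⟨v, hv⟩, ⟨s, hs⟩)
  · simpa using hx

end Generators

/-! ### Convergence of trajectories to piecewise constant flows -/

section Follows

variable {V E Y : Type*} [NormedAddCommGroup V] [NormedAddCommGroup E] [NormedSpace ℝ E]
  [NormedAddCommGroup Y] [NormedSpace ℝ Y] {P : Set V}

/-- The sequence of signals `q n` converges pointwise, except at the switching times, to the
piecewise constant signal that takes the value `v` for a duration `s`, for each letter `(v, s)`
of the word in turn. -/
def Follows : List (P × Ioi (0 : ℝ)) → (ℕ → ℝ → V) → Prop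
  | [], _ => True
  | l :: w, q => (∀ t ∈ Ioo 0 l.2.1, Tendsto (fun n => q n t) atTop (𝓝 l.1.1)) ∧
      Follows w fun n t => q n (t + l.2.1)

theorem Follows.congr {w : List (P × Ioi (0 : ℝ))} {q q' : ℕ → ℝ → V} (h : Follows w q)
    (hq : ∀ t > 0, Tendsto (fun n => q' n t - q n t) atTop (𝓝 0)) : Follows w q' := by
  induction w generalizing q q' with
  | nil => trivial
  | cons l w ih =>
    refine ⟨fun t ht => ?_, ih h.2 fun t ht => hq _ (add_pos ht l.2.2)⟩
    simpa using (hq t ht.1).add (h.1 t ht)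

theorem Follows.comp_tendsto {w : List (P × Ioi (0 : ℝ))} {q : ℕ → ℝ → V} (h : Follows w q)
    {φ : ℕ → ℕ} (hφ : Tendsto φ atTop atTop) : Follows w fun n => q (φ n) := by
  induction w generalizing q with
  | nil => trivial
  | cons l w ih => exact ⟨fun t ht => (h.1 t ht).comp hφ, ih h.2⟩

/-- Use the integrating factor exp(-tA(v)): the derivative of exp(-tA(v))W_n is exp(-tA(v))(A(q_n) -
A(v))W_n, which tends to 0 pointwise and is dominated thanks to Grönwall, so its integral tends to
0. -/
theorem tendsto_flow_of_tendsto [CompleteSpace E] {A : V → E →L[ℝ] E} (hA : Continuous A) {v : V} {s K : ℝ}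
    {q : ℕ → ℝ → V} (hq : ∀ n, Continuous (q n)) (hK : ∀ n t, ‖A (q n t)‖ ≤ K)
    (hqv : ∀ t ∈ Ioo 0 s, Tendsto (fun n => q n t) atTop (𝓝 v)) {W : ℕ → ℝ → E}
    (hW : ∀ n, ∀ t ≥ 0, HasDerivAt (W n) (A (q n t) (W n t)) t) {x : E}
    (hx : Tendsto (fun n => W n 0) atTop (𝓝 x)) {t : ℝ} (ht : t ∈ Icc 0 s) :
    Tendsto (fun n => W n t) atTop (𝓝 ((NormedSpace.exp (t • A v) : E →L[ℝ] E) x)) := by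
  set G : ℝ → E →L[ℝ] E := fun r => NormedSpace.exp (r • (-A v)) with hG
  have hGd : ∀ r, HasDerivAt G (G r * (-A v)) r := fun r =>
    hasDerivAt_exp_smul_const (𝕂 := ℝ) (𝔸 := E →L[ℝ] E) (-A v) r
  have hGc : Continuous G := continuous_iff_continuousAt.2 fun r => (hGd r).continuousAt
  have hWc : ∀ n, ContinuousOn (W n) (Icc 0 t) := fun n r hr =>
    (hW n r hr.1).continuousAt.continuousWithinAt
  obtain ⟨R, hR⟩ : ∃ R, ∀ n, ‖W n 0‖ ≤ R := by
    obtain ⟨R, hR⟩ := hx.norm.bddAbove_range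
    exact ⟨R, fun n => hR ⟨n, rfl⟩⟩
  have hK0 : 0 ≤ K := (norm_nonneg _).trans (hK 0 0)
  have hR0 : 0 ≤ R := (norm_nonneg _).trans (hR 0)
  have hWb : ∀ n, ∀ r ∈ Icc 0 t, ‖W n r‖ ≤ R * Real.exp (K * t) := by
    intro n r hr
    have := norm_le_gronwallBound_of_norm_deriv_right_le (ε := 0) (hWc n)
      (fun r hr => (hW n r hr.1).hasDerivWithinAt) (hR n)
      (fun r _ => by simpa using (A (q n r)).le_of_opNorm_le (hK n r) (W n r)) r hr
    rw [gronwallBound_ε0] at this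
    refine this.trans ?_
    have : K * (r - 0) ≤ K * t := by gcongr; linarith [hr.2]
    gcongr
  obtain ⟨B, hB⟩ := (isCompact_Icc (a := 0) (b := t)).exists_bound_of_continuousOn hGc.continuousOn
  let g : ℕ → ℝ → E := fun n r => G r (A (q n r) (W n r) - A v (W n r))
  have hd : ∀ n, ∀ r ∈ uIcc 0 t, HasDerivAt (fun r => G r (W n r)) (g n r) r := by
    intro n r hr
    rw [uIcc_of_le ht.1] at hr
    have := (hGd r).clm_apply (hW n r hr.1)
    convert this using 1
    simp [g, sub_eq_add_neg, add_comm]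
  have hgc : ∀ n, ContinuousOn (g n) (uIcc 0 t) := by
    intro n
    rw [uIcc_of_le ht.1]
    exact hGc.continuousOn.clm_apply
      ((((hA.comp (hq n)).continuousOn).clm_apply (hWc n)).sub ((A v).continuous.comp_continuousOn (hWc n)))
  have hint : Tendsto (fun n => ∫ r in (0 : ℝ)..t, g n r) atTop (𝓝 (∫ r in (0 : ℝ)..t, (0 : E))) := by
    refine intervalIntegral.tendsto_integral_filter_of_dominated_convergence
      (fun _ => B * ((K + ‖A v‖) * (R * Real.exp (K * t))))
      (Eventually.of_forall fun n =>
        ((hgc n).intervalIntegrable.def').aestronglyMeasurable)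
      (Eventually.of_forall fun n => ae_of_all _ fun r hr => ?_) intervalIntegrable_const ?_
    · rw [uIoc_of_le ht.1] at hr
      have hr' : r ∈ Icc 0 t := ⟨hr.1.le, hr.2⟩
      refine (G r).le_of_opNorm_le_of_le (hB r hr') ?_
      rw [← sub_apply]
      refine ContinuousLinearMap.le_of_opNorm_le_of_le _ ?_ (hWb n r hr')
      exact (norm_sub_le _ _).trans (by gcongr; exact hK n r)
    -- When `t = s`, convergence of the signals at the endpoint is unknown.
    · have hne : ∀ᵐ r : ℝ, r ≠ t := by simp [ae_iff, measure_singleton]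
      filter_upwards [hne] with r hrt hr
      rw [uIoc_of_le ht.1] at hr
      have hr' : r ∈ Ioo 0 s := ⟨hr.1, (lt_of_le_of_ne hr.2 hrt).trans_le ht.2⟩
      have h1 : Tendsto (fun n => ‖A (q n r) - A v‖ * (R * Real.exp (K * t))) atTop (𝓝 0) := by
        have := ((hA.tendsto v).comp (hqv r hr')).sub_const (A v)
        rw [sub_self] at this
        simpa using this.norm.mul_const (R * Real.exp (K * t))
      have h2 : Tendsto (fun n => A (q n r) (W n r) - A v (W n r)) atTop (𝓝 0) := by
        refine squeeze_zero_norm (fun n => ?_) h1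
        rw [← sub_apply]
        exact ContinuousLinearMap.le_of_opNorm_le_of_le _ le_rfl (hWb n r ⟨hr.1.le, hr.2⟩)
      have h3 := ((G r).continuous.tendsto 0).comp h2
      rw [map_zero] at h3
      exact h3
  have hlim : Tendsto (fun n => G t (W n t)) atTop (𝓝 x) := by
    have h0 : ∀ n, G t (W n t) = W n 0 + ∫ r in (0 : ℝ)..t, g n r := fun n => by
      rw [intervalIntegral.integral_eq_sub_of_hasDerivAt (hd n) (hgc n).intervalIntegrable]
      simp [hG]
    simp only [h0]
    simpa using hx.add hint
  have := (((NormedSpace.exp (t • A v) : E →L[ℝ] E).continuous.tendsto x).comp hlim)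
  refine this.congr fun n => ?_
  simp only [hG, Function.comp, smul_neg]
  exact exp_smul_apply_exp_neg_smul _ _ _

/-- Outputs are sampled at the midpoint of a letter because the signals need not converge at
switching times. The end state of one letter is the limiting initial state of the next. -/
theorem mem_unobs_of_follows [CompleteSpace E] {A : V → E →L[ℝ] E} (hA : Continuous A) {C : V → E →L[ℝ] Y}
    (hC : Continuous C) {K : ℝ} (w : List (P × Ioi (0 : ℝ))) {q : ℕ → ℝ → V}
    (hq : ∀ n, Continuous (q n)) (hK : ∀ n t, ‖A (q n t)‖ ≤ K) (hw : Follows w q)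
    {W : ℕ → ℝ → E} (hW : ∀ n, ∀ t ≥ 0, HasDerivAt (W n) (A (q n t) (W n t)) t) {x : E}
    (hx : Tendsto (fun n => W n 0) atTop (𝓝 x))
    (h0 : ∀ n, ∀ t ∈ Ioo 0 (duration w), C (q n t) (W n t) = 0) :
    x ∈ unobs (stepCT A) (outCT A C) w := by
  induction w generalizing q W x with
  | nil => trivial
  | cons l w ih =>
    have hs : 0 < l.2.1 := l.2.2
    have hdur : duration (l :: w) = l.2.1 + duration w := by simp [duration]
    have hd := duration_nonneg w
    rw [mem_unobs_cons]
    constructor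
    · have h1 := tendsto_flow_of_tendsto hA hq hK hw.1 hW hx (t := l.2.1 / 2)
        ⟨by linarith, by linarith⟩
      have h2 := (isBoundedBilinearMap_apply.continuous.tendsto _).comp
        (((hC.tendsto _).comp (hw.1 (l.2.1 / 2) ⟨by linarith, by linarith⟩)).prodMk_nhds h1)
      refine tendsto_nhds_unique h2 ?_
      refine tendsto_const_nhds.congr fun n => (h0 n _ ⟨by linarith, by linarith⟩).symm
    · refine ih (q := fun n t => q n (t + l.2.1)) (W := fun n t => W n (t + l.2.1))
        (fun n => (hq n).comp (by fun_prop)) (fun n t => hK n _) hw.2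
        (fun n t ht => ?_) ?_ fun n t ht => h0 n _ ⟨by linarith [ht.1], by linarith [ht.2]⟩
      · exact (hW n (t + l.2.1) (by linarith)).comp_add_const t l.2.1
      · have := tendsto_flow_of_tendsto hA hq hK hw.1 hW hx (t := l.2.1) ⟨hs.le, le_rfl⟩
        simpa [stepCT] using this

end Follows

/-! ### Analytic approximation by sigmoids -/

section Smoothing

variable {V : Type*} [NormedAddCommGroup V] [NormedSpace ℝ V] {P : Set V}

/-- The piecewise constant signal described by a word, with jumps replaced by sigmoids of
slope `a`, and with the value `c` in the end. -/
noncomputable def smoothed (c : V) (a : ℝ) : List (P × Ioi (0 : ℝ)) → ℝ → V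
  | [] => fun _ => c
  | l :: w => fun t => (1 - Real.sigmoid (a * (t - l.2.1))) • l.1.1 +
      Real.sigmoid (a * (t - l.2.1)) • smoothed c a w (t - l.2.1)

theorem smoothed_mem {Q : Set V} (hQ : Convex ℝ Q) {c : V} (hc : c ∈ Q) (a : ℝ)
    (w : List (P × Ioi (0 : ℝ))) (hw : ∀ l ∈ w, l.1.1 ∈ Q) (t : ℝ) : smoothed c a w t ∈ Q := by
  induction w generalizing t with
  | nil => exact hc
  | cons l w ih =>
    exact hQ (hw l (by simp)) (ih (fun l hl => hw l (by simp [hl])) _)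
      (sub_nonneg.2 (Real.sigmoid_le_one _)) (Real.sigmoid_nonneg _) (by ring)

theorem exists_norm_smoothed_le (c : V) (w : List (P × Ioi (0 : ℝ))) :
    ∃ R, ∀ a t, ‖smoothed c a w t‖ ≤ R := by
  obtain ⟨R, hR⟩ : ∃ R, ‖c‖ ≤ R ∧ ∀ l ∈ w, ‖l.1.1‖ ≤ R := by
    induction w with
    | nil => exact ⟨‖c‖, le_rfl, by simp⟩
    | cons l w ih =>
      obtain ⟨R, h1, h2⟩ := ih
      refine ⟨max R ‖l.1.1‖, h1.trans (le_max_left _ _), ?_⟩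
      simp only [List.mem_cons, forall_eq_or_imp]
      exact ⟨le_max_right _ _, fun l hl => (h2 l hl).trans (le_max_left _ _)⟩
  refine ⟨R, fun a t => ?_⟩
  -- A ball is convex, so the bound is uniform in the slope.
  simpa using smoothed_mem (convex_closedBall (0 : V) R) (by simpa using hR.1) a w
    (fun l hl => by simpa using hR.2 l hl) t

theorem analyticOnNhd_smoothed (c : V) (a : ℝ) (w : List (P × Ioi (0 : ℝ))) :
    AnalyticOnNhd ℝ (smoothed c a w) univ := by
  induction w with
  | nil => exact analyticOnNhd_const
  | cons l w ih =>
    intro t _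
    have h1 : AnalyticAt ℝ (fun t => t - l.2.1) t := by fun_prop
    have h2 : AnalyticAt ℝ (fun t => Real.sigmoid (a * (t - l.2.1))) t :=
      AnalyticAt.sigmoid' (by fun_prop)
    exact ((analyticAt_const.sub h2).smul analyticAt_const).add
      (h2.smul ((ih _ trivial).fun_comp h1))

theorem follows_smoothed (c : V) (w : List (P × Ioi (0 : ℝ))) :
    Follows w fun n : ℕ => smoothed c n w := by
  induction w with
  | nil => trivial
  | cons l w ih =>
    obtain ⟨R, hR⟩ := exists_norm_smoothed_le c w
    refine ⟨fun t ht => ?_, ih.congr fun t ht => ?_⟩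
    · have hσ : Tendsto (fun n : ℕ => Real.sigmoid (n * (t - l.2.1))) atTop (𝓝 0) :=
        Real.tendsto_sigmoid_atBot.comp
          (tendsto_natCast_atTop_atTop.atTop_mul_const_of_neg (sub_neg.2 ht.2))
      have h1 : Tendsto (fun n : ℕ => Real.sigmoid (n * (t - l.2.1)) •
          smoothed c n w (t - l.2.1)) atTop (𝓝 0) :=
        squeeze_zero_norm (a := fun n : ℕ => ‖Real.sigmoid (n * (t - l.2.1))‖ * R) (fun n => by
          rw [norm_smul]
          exact mul_le_mul_of_nonneg_left (hR _ _) (norm_nonneg _))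
          (by simpa using hσ.norm.mul_const R)
      simpa [smoothed] using ((tendsto_const_nhds (x := (1 : ℝ))).sub hσ).smul_const l.1.1 |>.add h1
    -- After the switch the sigmoid tends to 1, so the signal approaches that of the remaining word.
    · have hσ : Tendsto (fun n : ℕ => 1 - Real.sigmoid (n * t)) atTop (𝓝 0) := by
        have := Real.tendsto_sigmoid_atTop.comp
          (tendsto_natCast_atTop_atTop.atTop_mul_const ht)
        simpa using (tendsto_const_nhds (x := (1 : ℝ))).sub this
      refine squeeze_zero_norm (a := fun n : ℕ =>
        ‖1 - Real.sigmoid (n * t)‖ * (‖l.1.1‖ + R)) (fun n => ?_) ?_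
      · have : smoothed c n (l :: w) (t + l.2.1) - smoothed c n w t =
            (1 - Real.sigmoid (n * t)) • (l.1.1 - smoothed c n w t) := by
          simp only [smoothed, add_sub_cancel_right]
          module
        rw [this, norm_smul]
        gcongr
        exact (norm_sub_le _ _).trans (by gcongr; exact hR _ _)
      · simpa using hσ.norm.mul_const (‖l.1.1‖ + R)

end Smoothing

/-! ### Measurability and boundedness of piecewise continuous signals -/

section PiecewiseContinuous

theorem countable_not_continuousAt_extendReal {n : ℕ} {f : ℝ≥0 → Fin n → ℝ}
    (hf : PiecewiseCont f) : {t | ¬ ContinuousAt (extendReal f) t}.Countable := by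
  have hD : {t | ¬ ContinuousAt f t}.Countable := by
    refine (countable_iUnion fun k : ℕ => (hf.1 k).countable).mono fun t ht => ?_
    obtain ⟨k, hk⟩ := exists_nat_ge t
    exact mem_iUnion.2 ⟨k, hk, ht⟩
  refine ((hD.image ((↑) : ℝ≥0 → ℝ)).union (countable_singleton 0)).mono fun t ht => ?_
  rcases lt_trichotomy t 0 with h | h | h
  · refine absurd (continuousAt_const.congr (x := t) (f := fun _ => f 0) ?_) ht
    filter_upwards [Iio_mem_nhds h] with s hs
    simp [extendReal, Real.toNNReal_of_nonpos (le_of_lt hs)]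
  · exact Or.inr h
  · refine Or.inl ⟨t.toNNReal, fun hc => ht ?_, Real.coe_toNNReal _ h.le⟩
    exact hc.comp continuous_real_toNNReal.continuousAt

theorem aestronglyMeasurable_extendReal {n : ℕ} {f : ℝ≥0 → Fin n → ℝ} (hf : PiecewiseCont f) :
    AEStronglyMeasurable (extendReal f) volume := by
  have hD := countable_not_continuousAt_extendReal hf
  have hc : ContinuousOn (extendReal f) {t | ¬ ContinuousAt (extendReal f) t}ᶜ := fun t ht =>
    (not_not.1 ht : ContinuousAt (extendReal f) t).continuousWithinAt
  have := hc.aestronglyMeasurable (μ := volume) hD.measurableSet.compl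
  have hae : ∀ᵐ t, t ∈ {t | ¬ ContinuousAt (extendReal f) t}ᶜ := hD.ae_notMem volume
  rwa [Measure.restrict_eq_self_of_ae_mem hae] at this

/-- One-sided limits bound the signal near each point; compactness makes the bound uniform. -/
theorem exists_bound_of_piecewiseCont {n : ℕ} {f : ℝ≥0 → Fin n → ℝ} (hf : PiecewiseCont f)
    (T : ℝ≥0) : ∃ K, ∀ t ≤ T, ‖f t‖ ≤ K := by
  have key : ∃ K, ∀ t ∈ Icc 0 T, ‖f t‖ ≤ K := by
    refine (isCompact_Icc (a := (0 : ℝ≥0)) (b := T)).induction_on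
      (p := fun s => ∃ K, ∀ t ∈ s, ‖f t‖ ≤ K) ⟨0, by simp⟩
      (fun s t hst ⟨K, hK⟩ => ⟨K, fun r hr => hK r (hst hr)⟩) ?_ fun t _ => ?_
    · rintro s t ⟨K, hK⟩ ⟨K', hK'⟩
      refine ⟨max K K', fun r hr => hr.elim (fun h => (hK r h).trans (le_max_left _ _))
        fun h => (hK' r h).trans (le_max_right _ _)⟩
    · obtain ⟨⟨l, hl⟩, l', hl'⟩ := hf.2 t
      obtain ⟨K, hK⟩ := hl.norm.isBoundedUnder_le
      obtain ⟨K', hK'⟩ := hl'.norm.isBoundedUnder_le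
      rw [eventually_map] at hK hK'
      refine ⟨_, mem_nhdsWithin_of_mem_nhds (s := {r | ‖f r‖ ≤ max (max K K') ‖f t‖}) ?_,
        max (max K K') ‖f t‖, fun r hr => hr⟩
      have h1 := eventually_nhdsWithin_iff.1 hK
      have h2 := eventually_nhdsWithin_iff.1 hK'
      filter_upwards [h1, h2] with r h1 h2
      rcases lt_trichotomy r t with h | rfl | h
      · exact (h2 h).trans ((le_max_right _ _).trans (le_max_left _ _))
      · exact le_max_right _ _
      · exact (h1 h).trans ((le_max_left _ _).trans (le_max_left _ _))
  simpa using key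

theorem exists_bound_comp_extendReal {n : ℕ} {F : Type*} [NormedAddCommGroup F]
    {Φ : (Fin n → ℝ) → F} (hΦ : Continuous Φ) {f : ℝ≥0 → Fin n → ℝ} (hf : PiecewiseCont f)
    (T : ℝ) : ∃ K, ∀ t ≤ T, ‖Φ (extendReal f t)‖ ≤ K := by
  obtain ⟨R, hR⟩ := exists_bound_of_piecewiseCont hf T.toNNReal
  obtain ⟨K, hK⟩ := (isCompact_closedBall (0 : Fin n → ℝ) R).exists_bound_of_continuousOn
    hΦ.continuousOn
  exact ⟨K, fun t ht => hK _ (by simpa [extendReal] using hR _ (Real.toNNReal_le_toNNReal ht))⟩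

end PiecewiseContinuous

/-! ### Absolute continuity and integral equations -/

section AbsolutelyContinuous

variable {E : Type*} [NormedAddCommGroup E] [NormedSpace ℝ E]

theorem absolutelyContinuousOnInterval_add_integral {f z : ℝ → E} {x₀ : E}
    (hf : ∀ a b, IntervalIntegrable f volume a b) {T : ℝ} (hT : 0 ≤ T) {K : ℝ}
    (hK : ∀ t ∈ Icc 0 T, ‖f t‖ ≤ K)
    (hz : ∀ t ∈ Icc 0 T, z t = x₀ + ∫ s in (0 : ℝ)..t, f s) :
    AbsolutelyContinuousOnInterval z 0 T := by
  refine LipschitzOnWith.absolutelyContinuousOnInterval (K := K.toNNReal) ?_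
  rw [uIcc_of_le hT]
  refine LipschitzOnWith.of_dist_le_mul fun a ha b hb => ?_
  rw [hz a ha, hz b hb, dist_add_left, dist_eq_norm,
    intervalIntegral.integral_interval_sub_left (hf _ _) (hf _ _), Real.dist_eq,
    Real.coe_toNNReal _ ((norm_nonneg _).trans (hK a ha))]
  refine intervalIntegral.norm_integral_le_of_norm_le_const fun s hs => hK s ?_
  exact uIcc_subset_Icc hb ha (uIoc_subset_uIcc hs)

theorem ae_hasDerivAt_of_eq_add_integral [CompleteSpace E] {f z : ℝ → E} {x₀ : E}
    (hf : ∀ a b, IntervalIntegrable f volume a b)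
    (hz : ∀ t ≥ 0, z t = x₀ + ∫ s in (0 : ℝ)..t, f s) :
    ∀ᵐ s, 0 < s → HasDerivAt z (f s) s := by
  have hloc : LocallyIntegrable f volume := fun t =>
    ⟨Ioc (t - 1) (t + 1), Ioc_mem_nhds (by linarith) (by linarith), (hf _ _).1⟩
  filter_upwards [LocallyIntegrable.ae_hasDerivAt_integral hloc] with s hs h0
  refine ((hs 0).const_add x₀).congr_of_eventuallyEq ?_
  filter_upwards [Ioi_mem_nhds h0] with t ht using hz t (le_of_lt ht)

/-- The difference from the primitive of `g` is absolutely continuous with derivative zero almost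
everywhere, hence constant. -/
theorem eq_add_integral_of_ae_hasDerivAt [CompleteSpace E] {g z : ℝ → E} (hg : Continuous g)
    {t : ℝ} (ht : 0 ≤ t) (hz : AbsolutelyContinuousOnInterval z 0 t)
    (hd : ∀ᵐ s, 0 < s → HasDerivAt z (g s) s) : z t = z 0 + ∫ s in (0 : ℝ)..t, g s := by
  obtain ⟨K, hK⟩ := (isCompact_Icc (a := (0 : ℝ)) (b := t)).exists_bound_of_continuousOn
    hg.continuousOn
  have hI := absolutelyContinuousOnInterval_add_integral (x₀ := 0)
    (fun a b => hg.intervalIntegrable a b) ht hK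
    (z := fun t => ∫ s in (0 : ℝ)..t, g s) (fun _ _ => (zero_add _).symm)
  have h0 : ∀ᵐ s : ℝ, s ≠ 0 := by simp [ae_iff, measure_singleton]
  obtain ⟨c, hc⟩ := (hz.sub hI).const_of_ae_hasDerivAt_zero <| by
    filter_upwards [hd, h0] with s hs hs0 hmem
    rw [uIcc_of_le ht] at hmem
    simpa using (hs (lt_of_le_of_ne hmem.1 hs0.symm)).sub (hg.integral_hasStrictDerivAt 0 s).hasDerivAt
  have h1 := hc 0 left_mem_uIcc
  have h2 := hc t right_mem_uIcc
  simp only [Pi.sub_apply, intervalIntegral.integral_same, sub_zero] at h1 h2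
  rw [h1, ← h2, sub_add_cancel]

end AbsolutelyContinuous

/-! ### Continuous time -/

section ContinuousTime

/-- The affine matrix function of a family of matrices, with operators as values. -/
noncomputable def affineCLM {m n np : ℕ} (M : Fin (np + 1) → Matrix (Fin m) (Fin n) ℝ)
    (v : Fin np → ℝ) : (Fin n → ℝ) →L[ℝ] (Fin m → ℝ) :=
  LinearMap.toContinuousLinearMap (Matrix.toLin' (affineEval M v))

@[simp]
theorem affineCLM_apply {m n np : ℕ} (M : Fin (np + 1) → Matrix (Fin m) (Fin n) ℝ)
    (v : Fin np → ℝ) (x : Fin n → ℝ) : affineCLM M v x = affineEval M v *ᵥ x := rfl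

theorem continuous_affineCLM {m n np : ℕ} (M : Fin (np + 1) → Matrix (Fin m) (Fin n) ℝ) :
    Continuous (affineCLM M) := by
  have h1 : Continuous (affineEval M) := by
    unfold affineEval
    fun_prop
  have h2 : Continuous (Matrix.toLin' (R := ℝ) (m := Fin m) (n := Fin n)
      |>.trans LinearMap.toContinuousLinearMap).toLinearMap :=
    LinearMap.continuous_of_finiteDimensional _
  exact h2.comp h1

/-- Linear differential equations with piecewise continuous coefficients have solutions in
invariant subspaces. -/
theorem exists_solution_mem {n np : ℕ} {A : (Fin np → ℝ) → (Fin n → ℝ) →L[ℝ] (Fin n → ℝ)}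
    (hA : Continuous A) {p : ℝ≥0 → Fin np → ℝ} (hp : PiecewiseCont p)
    {Z : Submodule ℝ (Fin n → ℝ)} (hZ : ∀ t, ∀ z ∈ Z, A (p t) z ∈ Z) {ξ : Fin n → ℝ}
    (hξ : ξ ∈ Z) : ∃ z : ℝ → Fin n → ℝ, Continuous z ∧ (∀ t, z t ∈ Z) ∧
      ∀ t ≥ 0, z t = ξ + ∫ s in (0 : ℝ)..t, A (extendReal p s) (z s) := by
  -- A projection onto `Z` lets the equation be posed and solved inside `Z`; by invariance, the
  -- projection does not alter the values of the operator there.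
  obtain ⟨π, hπ⟩ := Z.subtype.exists_leftInverse_of_injective Z.ker_subtype
  have hπz : ∀ z : Z, π z = z := fun z => LinearMap.congr_fun hπ z
  have hΦ : Continuous fun v => (LinearMap.toContinuousLinearMap π) ∘L A v ∘L Z.subtypeL :=
    continuous_const.clm_comp (hA.clm_comp continuous_const)
  have hM := hΦ.comp_aestronglyMeasurable (aestronglyMeasurable_extendReal hp)
  have hb := exists_bound_comp_extendReal (F := Z →L[ℝ] Z) hΦ hp
  obtain ⟨w, hw, hwt⟩ := exists_volterra_solution hM hb ⟨ξ, hξ⟩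
  refine ⟨fun t => w t, by fun_prop, fun t => (w t).2, fun t ht => ?_⟩
  have h1 := congrArg Z.subtypeL (hwt t ht)
  rw [map_add, ← ContinuousLinearMap.intervalIntegral_comp_comm _ (intervalIntegrable_clm_apply
    hM hb hw _ _)] at h1
  refine h1.trans ?_
  congr 1
  refine intervalIntegral.integral_congr fun s _ => ?_
  exact congrArg Subtype.val (hπz ⟨A (extendReal p s) (w s), hZ _ _ (w s).2⟩)

namespace LPVSSA

variable {nx nu ny np : ℕ}

theorem ioCT_subset_add (S : LPVSSA nx nu ny np) {Z : Submodule ℝ (Fin nx → ℝ)}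
    (hA : ∀ v ∈ S.P, ∀ z ∈ Z, affineCLM S.A v z ∈ Z)
    (hC : ∀ v ∈ S.P, ∀ z ∈ Z, affineCLM S.C v z = 0) (x : Fin nx → ℝ) {ξ : Fin nx → ℝ}
    (hξ : ξ ∈ Z) (u : SignalCT nu) (p : SchedCT S.P) : S.ioCT x u p ⊆ S.ioCT (x + ξ) u p := by
  rintro y ⟨X, ⟨hXac, hX⟩, rfl⟩
  have hcont := continuous_affineCLM S.A
  obtain ⟨z, hz, hzZ, hzt⟩ := exists_solution_mem hcont p.2.1 (fun t => hA _ (p.2.2 t)) hξ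
  have hint : ∀ a b, IntervalIntegrable (fun s => affineCLM S.A (extendReal p.1 s) (z s))
      volume a b := intervalIntegrable_clm_apply
    (hcont.comp_aestronglyMeasurable (aestronglyMeasurable_extendReal p.2.1))
    (exists_bound_comp_extendReal hcont p.2.1) hz
  have hext : ∀ t ≥ 0, extendReal (fun t : ℝ≥0 => z t) t =
      ξ + ∫ s in (0 : ℝ)..t, affineCLM S.A (extendReal p.1 s) (z s) := fun t ht => by
    rw [← hzt t ht, extendReal, Real.coe_toNNReal t ht]
  refine ⟨fun t => X t + z t, ⟨fun T => ?_, ?_⟩, ?_⟩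
  · obtain ⟨K, hK⟩ := exists_bound_comp_extendReal hcont p.2.1 T
    obtain ⟨R, hR⟩ := (isCompact_Icc (a := (0 : ℝ)) (b := T)).exists_bound_of_continuousOn
      hz.continuousOn
    exact (hXac T).add (absolutelyContinuousOnInterval_add_integral hint T.2
      (fun t ht => ContinuousLinearMap.le_of_opNorm_le_of_le _ (hK t ht.2) (hR t ht))
      fun t ht => hext t ht.1)
  · have h0 : ∀ᵐ s : ℝ, s ≠ 0 := by simp [ae_iff, measure_singleton]
    filter_upwards [hX, ae_hasDerivAt_of_eq_add_integral hint hext, h0] with s hs hd hs0 t hts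
    have hpos : 0 < s := lt_of_le_of_ne (hts ▸ t.2) hs0.symm
    obtain ⟨h1, h2⟩ := hs t hts
    have hpt : extendReal p.1 s = p.1 t := by simp [extendReal, ← hts]
    constructor
    · have := h1.add (hd hpos)
      rw [hpt, affineCLM_apply, ← hts] at this
      rw [← hts, Matrix.mulVec_add, add_right_comm]
      exact this
    · have := hC _ (p.2.2 t) _ (hzZ t)
      rw [affineCLM_apply] at this
      rw [h2, Matrix.mulVec_add, this, add_zero]
  · simpa using hzt 0 le_rfl

theorem ioCT_add_eq (S : LPVSSA nx nu ny np) {Z : Submodule ℝ (Fin nx → ℝ)}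
    (hA : ∀ v ∈ S.P, ∀ z ∈ Z, affineCLM S.A v z ∈ Z)
    (hC : ∀ v ∈ S.P, ∀ z ∈ Z, affineCLM S.C v z = 0) (x : Fin nx → ℝ) {ξ : Fin nx → ℝ}
    (hξ : ξ ∈ Z) : S.ioCT (x + ξ) = S.ioCT x := by
  funext u p
  refine Subset.antisymm ?_ (S.ioCT_subset_add hA hC x hξ u p)
  simpa using S.ioCT_subset_add hA hC (x + ξ) (Z.neg_mem hξ) u p

/-- Two states whose zero-input outputs agree for a continuous scheduling signal differ by a state
whose classical trajectory has output zero. -/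
theorem exists_trajectory_of_outputs_eq (S : LPVSSA nx nu ny np) {p : SchedCT S.P}
    {q : ℝ → Fin np → ℝ} (hq : Continuous q) (hpq : ∀ t : ℝ≥0, p.1 t = q t) {T : ℝ≥0}
    {x₁ x₂ : Fin nx → ℝ} {y₁ y₂ : SignalCT ny} (h₁ : y₁ ∈ S.ioCT x₁ 0 p)
    (h₂ : y₂ ∈ S.ioCT x₂ 0 p) (hy : ∀ t ≤ T, y₁.1 t = y₂.1 t) :
    ∃ W : ℝ → Fin nx → ℝ, W 0 = x₁ - x₂ ∧
      (∀ t ≥ 0, HasDerivAt W (affineCLM S.A (q t) (W t)) t) ∧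
      ∀ t ∈ Ioo 0 (T : ℝ), affineCLM S.C (q t) (W t) = 0 := by
  obtain ⟨X₁, ⟨hac₁, hX₁⟩, rfl⟩ := h₁
  obtain ⟨X₂, ⟨hac₂, hX₂⟩, rfl⟩ := h₂
  set X : ℝ → Fin nx → ℝ := fun t => extendReal X₁ t - extendReal X₂ t with hXdef
  have hac : ∀ T : ℝ≥0, AbsolutelyContinuousOnInterval X 0 T := fun T => (hac₁ T).sub (hac₂ T)
  have hXc : Continuous fun t : ℝ => X (max t 0) := by
    refine continuous_iff_continuousAt.2 fun t => ?_
    have h1 := (hac (t + 1).toNNReal).continuousOn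
    rw [uIcc_of_le (NNReal.coe_nonneg _)] at h1
    have h2 : ContinuousOn (fun t : ℝ => X (max t 0)) (Iic (t + 1)) :=
      h1.comp (by fun_prop) fun s hs => ⟨le_max_right _ _, by
        rw [Real.coe_toNNReal']; exact max_le_max_right 0 hs⟩
    exact h2.continuousAt (Iic_mem_nhds (by linarith))
  set g : ℝ → Fin nx → ℝ := fun t => affineCLM S.A (q t) (X (max t 0)) with hgdef
  have hg : Continuous g := ((continuous_affineCLM S.A).comp hq).clm_apply hXc
  have hu : ∀ t, (0 : SignalCT nu).1 t = 0 := fun _ => rfl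
  have hd : ∀ᵐ s : ℝ, 0 < s → HasDerivAt X (g s) s := by
    filter_upwards [hX₁, hX₂] with s h₁ h₂ hs
    have := (h₁ s.toNNReal (Real.coe_toNNReal s hs.le)).1.fun_sub
      (h₂ s.toNNReal (Real.coe_toNNReal s hs.le)).1
    refine this.congr_deriv ?_
    simp [hgdef, hXdef, hu, hpq, extendReal, hs.le, Matrix.mulVec_sub]
  have hXI : ∀ t ≥ 0, X t = X 0 + ∫ s in (0 : ℝ)..t, g s := fun t ht =>
    eq_add_integral_of_ae_hasDerivAt hg ht (by simpa [ht] using hac t.toNNReal) hd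
  -- The primitive replaces `X`, which is constant for negative times and may lack a two-sided
  -- derivative at 0.
  refine ⟨fun t => X 0 + ∫ s in (0 : ℝ)..t, g s, by simp [hXdef, extendReal], fun t ht => ?_,
    fun t ht => ?_⟩
  · have := ((hg.integral_hasStrictDerivAt 0 t).hasDerivAt).const_add (X 0)
    beta_reduce
    rwa [← hXI t ht, show X t = X (max t 0) by rw [max_eq_left ht]]
  · have hC : Continuous fun t => affineCLM S.C (q t) (X (max t 0)) :=
      ((continuous_affineCLM S.C).comp hq).clm_apply hXc
    have hae : (fun t => affineCLM S.C (q t) (X (max t 0))) =ᵐ[volume.restrict (Ioo 0 (T : ℝ))]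
        fun _ => 0 := by
      refine (ae_restrict_iff' measurableSet_Ioo).2 ?_
      filter_upwards [hX₁, hX₂] with s h₁ h₂ hs
      have e₁ := (h₁ s.toNNReal (Real.coe_toNNReal s hs.1.le)).2
      have e₂ := (h₂ s.toNNReal (Real.coe_toNNReal s hs.1.le)).2
      have := hy s.toNNReal (Real.toNNReal_le_iff_le_coe.2 hs.2.le)
      rw [e₁, e₂] at this
      simpa [hXdef, hu, hpq, extendReal, hs.1.le, Matrix.mulVec_sub, sub_eq_zero] using this
    -- Continuity upgrades the almost everywhere output equation to every point of the open
    -- interval.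
    have := Measure.eqOn_open_of_ae_eq hae isOpen_Ioo hC.continuousOn continuousOn_const ht
    simp only [max_eq_left ht.1.le] at this
    beta_reduce
    rwa [← hXI t ht.1.le]

theorem exists_universal_schedule_CT (S : LPVSSA nx nu ny np) (hS : S.RegularCT)
    (hobs : S.ObservableCT) :
    ∃ (p : SchedCT S.P) (T : ℝ≥0), AnalyticSignal p.1 ∧
      ∀ (x₁ x₂ : Fin nx → ℝ), ∀ y₁ ∈ S.ioCT x₁ 0 p, ∀ y₂ ∈ S.ioCT x₂ 0 p,
        (∀ t ≤ T, y₁.1 t = y₂.1 t) → S.ioCT x₁ = S.ioCT x₂ := by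
  obtain ⟨hconv, c, hc⟩ := hS
  replace hc : c ∈ S.P := interior_subset hc
  have hAc := continuous_affineCLM S.A
  have hZ : ⨅ w : List (S.P × Ioi (0 : ℝ)),
      unobs (stepCT (affineCLM S.A)) (outCT (affineCLM S.A) (affineCLM S.C)) w = ⊥ := by
    refine (Submodule.eq_bot_iff _).2 fun ξ hξ => ?_
    by_contra hne
    exact hobs (0 + ξ) 0 (by simpa using hne) (S.ioCT_add_eq
      (fun v hv z hz => generator_mem_iInf_unobs hz hv)
      (fun v hv z hz => output_eq_zero_of_mem_iInf_unobs hz hv) 0 hξ)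
  obtain ⟨w, hw⟩ := exists_unobs_eq_bot (stepCT_injective _) hZ
  have hqan := fun n : ℕ => analyticOnNhd_smoothed c n w
  have hqc : ∀ n : ℕ, Continuous (smoothed c n w) := fun n =>
    continuousOn_univ.1 (hqan n).continuousOn
  let p : ℕ → SchedCT S.P := fun n => ⟨fun t => smoothed c n w t,
    PiecewiseCont.of_continuous ((hqc n).comp NNReal.continuous_coe),
    fun t => smoothed_mem hconv hc _ w (fun l _ => l.1.2) _⟩
  have hpan : ∀ n, AnalyticSignal (p n).1 := fun n =>
    ((hqan n).analyticOn.mono (subset_univ _)).congr fun t ht => by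
      simp [p, extendReal, mem_Ici.1 ht]
  by_contra! hcon
  choose x₁ x₂ y₁ h₁ y₂ h₂ hy hne using fun n =>
    hcon (p n) ⟨duration w, duration_nonneg w⟩ (hpan n)
  choose W hW0 hW hWC using fun n =>
    S.exists_trajectory_of_outputs_eq (hqc n) (fun _ => rfl) (h₁ n) (h₂ n) (hy n)
  have hW0ne : ∀ n, W n 0 ≠ 0 := fun n h => hne n (by rw [sub_eq_zero.1 ((hW0 n).symm.trans h)])
  -- By linearity the undetected initial states can be scaled to the compact unit sphere, so the
  -- limit is nonzero.
  obtain ⟨x, hx, φ, hφ, hlim⟩ := (isCompact_sphere (0 : Fin nx → ℝ) 1).tendsto_subseq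
    (x := fun n => ‖W n 0‖⁻¹ • W n 0) fun n => by simp [norm_smul, hW0ne n]
  obtain ⟨R, hR⟩ := exists_norm_smoothed_le c w
  obtain ⟨K, hK⟩ := (isCompact_closedBall (0 : Fin np → ℝ) R).exists_bound_of_continuousOn
    hAc.continuousOn
  have hmem := mem_unobs_of_follows hAc (continuous_affineCLM S.C) w (fun n => hqc (φ n))
    (fun n t => hK _ (by simpa using hR _ t))
    ((follows_smoothed c w).comp_tendsto hφ.tendsto_atTop)
    (W := fun n t => ‖W (φ n) 0‖⁻¹ • W (φ n) t)
    (fun n t ht => by simpa using (hW (φ n) t ht).fun_const_smul ‖W (φ n) 0‖⁻¹) hlim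
    (fun n t ht => by rw [map_smul, hWC (φ n) t ht, smul_zero])
  rw [hw, Submodule.mem_bot] at hmem
  simp [hmem] at hx

end LPVSSA

end ContinuousTime

theorem mainTheorem5 {nx nu ny np : ℕ} (S : LPVSSA nx nu ny np) :
    (S.RegularCT → S.ObservableCT →
      ∃ (p : SchedCT S.P) (T : ℝ≥0), AnalyticSignal p.1 ∧
        ∀ (x₁ x₂ : Fin nx → ℝ), ∀ y₁ ∈ S.ioCT x₁ 0 p, ∀ y₂ ∈ S.ioCT x₂ 0 p,
          (∀ t ≤ T, y₁.1 t = y₂.1 t) → S.ioCT x₁ = S.ioCT x₂) ∧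
    (S.RegularDT → S.ObservableDT →
      ∃ (p : SchedDT S.P) (T : ℕ),
        ∀ (x₁ x₂ : Fin nx → ℝ), ∀ y₁ ∈ S.ioDT x₁ 0 p, ∀ y₂ ∈ S.ioDT x₂ 0 p,
          (∀ t ≤ T, y₁ t = y₂ t) → S.ioDT x₁ = S.ioDT x₂) :=
  ⟨S.exists_universal_schedule_CT, S.exists_universal_schedule_DT⟩
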